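/- Let $n\ge 1$ be an integer. Identify a point $a=(a_0,\dots,a_{n-1})\in\mathbb{C}^n$ with the monic polynomial $F_a(x)=x^n+a_{n-1}x^{n-1}+\cdots+a_1x+a_0$, and equip $\mathbb{C}^n$ with the Zariski topology. For an integer $k$ let $Z_k\subseteq\mathbb{C}^n$ be the set of all $a$ such that $F_a$ has at most $k$ distinct complex roots. For a partition $\mu=(\mu_1,\dots,\mu_m)$ of $n$ into $\#\mu=m$ positive parts, let the coincident root locus $C_\mu\subseteq\mathbb{C}^n$ be the set of all $a$ such that $F_a(x)=\prod_{i=1}^m(x-x_i)^{\mu_i}$ for some $x_1,\dots,x_m\in\mathbb{C}$, not necessarily distinct. (a) For every partition $\mu$ of $n$, the set $C_\mu$ is an irreducible closed subset of $\mathbb{C}^n$ of dimension $\#\mu$. (b) For every $1\le k\le n$, $$Z_k=\bigcup_{\#\mu=k}C_\mu ,$$ the union being over all partitions $\mu$ of $n$ with exactly $k$ parts, and this is the irreducible decomposition of $Z_k$: $C_\mu\not\subseteq C_\nu$ for distinct partitions $\mu\ne\nu$ of $n$ with $\#\mu=\#\nu=k$, and the irreducible components of $Z_k$ are exactly the sets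 $C_\mu$ with $\#\mu=k$. In particular, $Z_k$ is equidimensional of dimension $k$: every irreducible component of $Z_k$ has dimension $k$, and $\dim Z_k=k$. -/

import Mathlib

noncomputable section

/-- The affine space `ℂⁿ`, with coordinates `a 0, …, a (n - 1)`.  It is a separate type (not an
abbreviation of `Fin n → ℂ`) so that it carries the Zariski topology and not the Euclidean one. -/
def ComplexAffineSpace (n : ℕ) : Type := Fin n → ℂ

/-- The common zero set in `ℂⁿ` of a set of polynomials in `n` variables. -/
def algebraicSet {n : ℕ} (S : Set (MvPolynomial (Fin n) ℂ)) : Set (ComplexAffineSpace n) :=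
  {a | ∀ p ∈ S, MvPolynomial.eval a p = 0}

/-- The Zariski topology on `ℂⁿ`: the closed sets are exactly the algebraic sets. -/
instance zariskiTopologicalSpace (n : ℕ) : TopologicalSpace (ComplexAffineSpace n) :=
  TopologicalSpace.ofClosed {V | ∃ S : Set (MvPolynomial (Fin n) ℂ), V = algebraicSet S}
    ⟨{1}, by ext a; simp [algebraicSet]⟩
    (by
      intro A hA
      refine ⟨{p | ∀ a ∈ ⋂₀ A, MvPolynomial.eval a p = 0}, ?_⟩
      ext a
      refine ⟨fun ha p hp => hp a ha, fun ha V hV => ?_⟩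
      obtain ⟨S, rfl⟩ := hA hV
      intro p hp
      exact ha p fun b hb => hb _ hV p hp)
    (by
      rintro _ ⟨S, rfl⟩ _ ⟨T, rfl⟩
      refine ⟨{r | ∃ p ∈ S, ∃ q ∈ T, r = p * q}, ?_⟩
      ext a
      constructor
      · rintro (ha | ha) _ ⟨p, hp, q, hq, rfl⟩
        · simp [ha p hp]
        · simp [ha q hq]
      · intro ha
        by_contra h
        simp only [Set.mem_union, not_or, algebraicSet, Set.mem_ofPred_eq, not_forall] at h
        obtain ⟨⟨p, hp, hpa⟩, ⟨q, hq, hqa⟩⟩ := h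
        have := ha (p * q) ⟨p, hp, q, hq, rfl⟩
        rw [map_mul] at this
        exact (mul_ne_zero hpa hqa) this)

theorem zariski_isClosed_iff {n : ℕ} {V : Set (ComplexAffineSpace n)} :
    IsClosed V ↔ ∃ S : Set (MvPolynomial (Fin n) ℂ), V = algebraicSet S := by
  rw [← isOpen_compl_iff]
  change Vᶜᶜ ∈ {V | ∃ S : Set (MvPolynomial (Fin n) ℂ), V = algebraicSet S} ↔ _
  rw [compl_compl, Set.mem_ofPred_eq]

/-- The monic polynomial `xⁿ + a_{n-1} xⁿ⁻¹ + ⋯ + a₁ x + a₀` with coefficient vector `a`. -/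
def monicPolynomial {n : ℕ} (a : ComplexAffineSpace n) : Polynomial ℂ :=
  Polynomial.X ^ n + ∑ i : Fin n, Polynomial.C (a i) * Polynomial.X ^ (i : ℕ)

/-- `Z_k ⊆ ℂⁿ`: the monic polynomials of degree `n` with at most `k` distinct complex roots. -/
def distinctRootLocus (n k : ℕ) : Set (ComplexAffineSpace n) :=
  {a | (monicPolynomial a).roots.toFinset.card ≤ k}

/-- The parts `μ₁ ≥ μ₂ ≥ ⋯ ≥ μ_m` of a partition, as a list. -/
def partList {n : ℕ} (μ : n.Partition) : List ℕ :=
  μ.parts.sort (fun i j => j ≤ i)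

/-- The coincident root locus `C_μ ⊆ ℂⁿ`: the monic polynomials of the form
`(x - x₁)^{μ₁} ⋯ (x - x_m)^{μ_m}` with `x₁, …, x_m` complex numbers, not necessarily distinct. -/
def coincidentRootLocus {n : ℕ} (μ : n.Partition) : Set (ComplexAffineSpace n) :=
  {a | ∃ x : Fin (partList μ).length → ℂ,
    monicPolynomial a =
      ∏ i, (Polynomial.X - Polynomial.C (x i)) ^ ((partList μ).get i)}

end

/-! Each `C_μ` with `m` parts is the image of the polynomial map from `ℂᵐ` to `ℂⁿ` that sends roots
`x` to the coefficients of `∏ (X - xᵢ)^{μᵢ}`. The image of an irreducible space is irreducible. The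
map on coordinate rings is integral, since every variable is a root of the generic product, a monic
polynomial with coefficients in the image (`isIntegral_aeval_genericCoeff`). Integrality gives the
rest of (a): lying over makes the image closed, going up bounds its dimension by `m`, and
incomparability shows that `m` is attained.

For (b), a multiset of `n` roots with at most `k ≤ n` distinct values splits into exactly `k`
constant blocks, whose sizes form a partition. A point of `C_μ` with distinct `xᵢ` recovers `μ` from
its root multiplicities, so no `C_μ` contains another with the same number of parts. The components
and the dimension then follow from general topology of finite closed unions. -/

/-! ### Zariski closed sets and their ideals. -/

theorem mem_algebraicSet {n : ℕ} {S : Set (MvPolynomial (Fin n) ℂ)} {a : ComplexAffineSpace n} :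
    a ∈ algebraicSet S ↔ ∀ p ∈ S, MvPolynomial.eval a p = 0 :=
  Iff.rfl

theorem isClosed_algebraicSet {n : ℕ} (S : Set (MvPolynomial (Fin n) ℂ)) :
    IsClosed (algebraicSet S) :=
  zariski_isClosed_iff.2 ⟨S, rfl⟩

theorem isClosed_setOf_eval_eq_zero {n : ℕ} (p : MvPolynomial (Fin n) ℂ) :
    IsClosed {a : ComplexAffineSpace n | MvPolynomial.eval a p = 0} :=
  zariski_isClosed_iff.2 ⟨{p}, by ext; simp [algebraicSet]⟩

theorem algebraicSet_anti {n : ℕ} {S T : Set (MvPolynomial (Fin n) ℂ)} (h : S ⊆ T) :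
    algebraicSet T ⊆ algebraicSet S :=
  fun _ ha p hp => ha p (h hp)

/-- The ideal of polynomials vanishing on a subset of `ℂⁿ`. -/
noncomputable def idealOfSet {n : ℕ} (V : Set (ComplexAffineSpace n)) :
    Ideal (MvPolynomial (Fin n) ℂ) :=
  MvPolynomial.vanishingIdeal ℂ (show Set (Fin n → ℂ) from V)

theorem mem_idealOfSet {n : ℕ} {V : Set (ComplexAffineSpace n)} {p : MvPolynomial (Fin n) ℂ} :
    p ∈ idealOfSet V ↔ ∀ a ∈ V, MvPolynomial.eval a p = 0 :=
  Iff.rfl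

/-- The Nullstellensatz, a prime ideal being radical. -/
theorem idealOfSet_algebraicSet {n : ℕ} (P : Ideal (MvPolynomial (Fin n) ℂ)) [P.IsPrime] :
    idealOfSet (algebraicSet (P : Set (MvPolynomial (Fin n) ℂ))) = P :=
  MvPolynomial.IsPrime.vanishingIdeal_zeroLocus (K := ℂ) P

theorem algebraicSet_idealOfSet {n : ℕ} {V : Set (ComplexAffineSpace n)} (hV : IsClosed V) :
    algebraicSet (idealOfSet V : Set (MvPolynomial (Fin n) ℂ)) = V := by
  obtain ⟨S, rfl⟩ := zariski_isClosed_iff.1 hV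
  exact Set.Subset.antisymm (algebraicSet_anti fun p hp a ha => ha p hp) fun a ha p hp => hp a ha

theorem isPrime_idealOfSet {n : ℕ} {V : Set (ComplexAffineSpace n)} (hV : IsIrreducible V) :
    (idealOfSet V).IsPrime := by
  refine ⟨fun h => ?_, fun {p q} hpq => ?_⟩
  · obtain ⟨a, ha⟩ := hV.1
    simpa using mem_idealOfSet.1 ((Ideal.eq_top_iff_one _).1 h) a ha
  · refine isPreirreducible_iff_isClosed_union_isClosed.1 hV.2 _ _
      (isClosed_setOf_eval_eq_zero p) (isClosed_setOf_eval_eq_zero q) fun a ha => ?_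
    have := mem_idealOfSet.1 hpq a ha
    rwa [map_mul, mul_eq_zero] at this

theorem isIrreducible_algebraicSet {n : ℕ} (P : Ideal (MvPolynomial (Fin n) ℂ)) [hP : P.IsPrime] :
    IsIrreducible (algebraicSet (P : Set (MvPolynomial (Fin n) ℂ))) := by
  have hI := idealOfSet_algebraicSet P
  refine ⟨?_, isPreirreducible_iff_isClosed_union_isClosed.2 fun Z W hZ hW h => ?_⟩
  · rw [Set.nonempty_iff_ne_empty]
    intro h
    refine hP.ne_top (hI.symm.trans ((Ideal.eq_top_iff_one _).2 ?_))
    simp [h, mem_idealOfSet]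
  · obtain ⟨S, rfl⟩ := zariski_isClosed_iff.1 hZ
    obtain ⟨T, rfl⟩ := zariski_isClosed_iff.1 hW
    by_contra hc
    simp only [not_or, Set.not_subset, mem_algebraicSet, not_forall] at hc
    obtain ⟨⟨a, ha, p, hp, hpa⟩, ⟨b, hb, q, hq, hqb⟩⟩ := hc
    have hpq : p * q ∈ P := by
      rw [← hI, mem_idealOfSet]
      intro x hx
      rcases h hx with hx | hx
      · simp [hx p hp]
      · simp [hx q hq]
    rcases hP.mem_or_mem hpq with h | h
    · exact hpa (ha p h)
    · exact hqb (hb q h)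

theorem isIrreducible_univ_complexAffineSpace (n : ℕ) :
    IsIrreducible (Set.univ : Set (ComplexAffineSpace n)) := by
  have := isIrreducible_algebraicSet (n := n) ⊥
  rwa [show algebraicSet ((⊥ : Ideal (MvPolynomial (Fin n) ℂ)) : Set (MvPolynomial (Fin n) ℂ)) =
    Set.univ by ext; simp [mem_algebraicSet]] at this

/-- The prime ideal of an irreducible closed subset of `ℂⁿ`. -/
noncomputable def primeOfIrreducibleClosed {n : ℕ}
    (V : TopologicalSpace.IrreducibleCloseds (ComplexAffineSpace n)) :
    PrimeSpectrum (MvPolynomial (Fin n) ℂ) :=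
  ⟨idealOfSet V.carrier, isPrime_idealOfSet V.isIrreducible'⟩

theorem primeOfIrreducibleClosed_strictAnti {n : ℕ} :
    StrictAnti (primeOfIrreducibleClosed (n := n)) := by
  intro V W h
  refine lt_of_le_not_ge (fun p hp a ha => hp a (h.le ha)) fun h' => h.not_ge ?_
  have : algebraicSet (idealOfSet W.carrier : Set (MvPolynomial (Fin n) ℂ)) ⊆
      algebraicSet (idealOfSet V.carrier) := algebraicSet_anti h'
  rwa [algebraicSet_idealOfSet V.isClosed', algebraicSet_idealOfSet W.isClosed'] at this

/-! ### Polynomial maps with integral map on coordinate rings. -/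

/-- The polynomial map `ℂᵐ → ℂⁿ` with components `F 0, …, F (n - 1)`. -/
noncomputable def polynomialMap {m n : ℕ} (F : Fin n → MvPolynomial (Fin m) ℂ)
    (x : ComplexAffineSpace m) : ComplexAffineSpace n :=
  fun j => MvPolynomial.eval x (F j)

section polynomialMap

variable {m n : ℕ} (F : Fin n → MvPolynomial (Fin m) ℂ)

theorem eval_polynomialMap (x : ComplexAffineSpace m) (p : MvPolynomial (Fin n) ℂ) :
    MvPolynomial.eval (polynomialMap F x) p = MvPolynomial.eval x (MvPolynomial.aeval F p) := by
  have : MvPolynomial.aeval (R := ℂ) (polynomialMap F x) =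
      (MvPolynomial.aeval (R := ℂ) x).comp (MvPolynomial.aeval F) := by
    refine MvPolynomial.algHom_ext fun i => ?_
    rw [AlgHom.comp_apply, MvPolynomial.aeval_X]
    exact (MvPolynomial.aeval_X _ _).trans rfl
  exact DFunLike.congr_fun this p

theorem continuous_polynomialMap : Continuous (polynomialMap F) := by
  refine continuous_iff_isClosed.2 fun V hV => ?_
  obtain ⟨S, rfl⟩ := zariski_isClosed_iff.1 hV
  refine zariski_isClosed_iff.2 ⟨MvPolynomial.aeval F '' S, ?_⟩
  ext x
  simp only [Set.mem_preimage, mem_algebraicSet, eval_polynomialMap, Set.forall_mem_image]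

theorem isIrreducible_range_polynomialMap : IsIrreducible (Set.range (polynomialMap F)) := by
  rw [← Set.image_univ]
  exact (isIrreducible_univ_complexAffineSpace m).image _ (continuous_polynomialMap F).continuousOn

variable {F} (hF : (MvPolynomial.aeval (R := ℂ) F).toRingHom.IsIntegral)
include hF

/-- The image is the zero set of the kernel: by lying over, the maximal ideal of a point of that
zero set is the contraction of a maximal ideal, which is again a point. -/
theorem isClosed_range_polynomialMap : IsClosed (Set.range (polynomialMap F)) := by
  refine zariski_isClosed_iff.2 ⟨{p | MvPolynomial.aeval F p = 0}, ?_⟩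
  refine Set.Subset.antisymm ?_ fun a ha => ?_
  · rintro _ ⟨x, rfl⟩ p hp
    rw [eval_polynomialMap, show MvPolynomial.aeval F p = 0 from hp, map_zero]
  · let _ := (MvPolynomial.aeval (R := ℂ) F).toRingHom.toAlgebra
    have : Algebra.IsIntegral (MvPolynomial (Fin n) ℂ) (MvPolynomial (Fin m) ℂ) := ⟨hF⟩
    let b : Fin n → ℂ := a
    obtain ⟨Q, hQ, hQa⟩ := Ideal.exists_ideal_over_maximal_of_isIntegral
      (S := MvPolynomial (Fin m) ℂ) (MvPolynomial.vanishingIdeal ℂ ({b} : Set (Fin n → ℂ)))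
      (fun p hp => (MvPolynomial.mem_vanishingIdeal_singleton_iff _ _).2 (ha p hp))
    obtain ⟨x, rfl⟩ := MvPolynomial.isMaximal_iff_eq_vanishingIdeal_singleton.1 hQ
    refine ⟨x, funext fun j => ?_⟩
    have h : (MvPolynomial.X j - MvPolynomial.C (b j)) ∈ MvPolynomial.vanishingIdeal ℂ {b} := by
      simp
    rw [← hQa, Ideal.mem_comap, MvPolynomial.mem_vanishingIdeal_singleton_iff] at h
    rw [show algebraMap (MvPolynomial (Fin n) ℂ) (MvPolynomial (Fin m) ℂ) =
      (MvPolynomial.aeval (R := ℂ) F).toRingHom from rfl] at h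
    simpa [polynomialMap, MvPolynomial.coe_aeval_eq_eval, sub_eq_zero] using h

/-- A chain of irreducible closed subsets of the image gives a chain of primes containing the
kernel, which going up lifts to the `m`-dimensional ring. -/
theorem topologicalKrullDim_range_polynomialMap_le :
    topologicalKrullDim (Set.range (polynomialMap F)) ≤ (m : WithBot ℕ∞) := by
  let _ := (MvPolynomial.aeval (R := ℂ) F).toRingHom.toAlgebra
  have : Algebra.IsIntegral (MvPolynomial (Fin n) ℂ) (MvPolynomial (Fin m) ℂ) := ⟨hF⟩
  have hcl := isClosed_range_polynomialMap hF
  let ι := TopologicalSpace.IrreducibleCloseds.map (Subtype.val : Set.range (polynomialMap F) → _)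
    continuous_subtype_val
  have hι : StrictMono ι :=
    TopologicalSpace.IrreducibleCloseds.map_strictMono_of_isInducing Topology.IsInducing.subtypeVal
  refine iSup_le fun l => ?_
  -- Taking ideals reverses inclusions, so the head of `L` is the prime of the largest set in `l`.
  let l' := ((l.map ι hι).map (fun V => OrderDual.toDual (primeOfIrreducibleClosed V))
    fun _ _ h => primeOfIrreducibleClosed_strictAnti h).reverse
  let L : LTSeries (PrimeSpectrum (MvPolynomial (Fin n) ℂ)) :=
    ⟨l'.length, fun i => OrderDual.ofDual (l' i), l'.step⟩
  obtain ⟨V, hV⟩ : ∃ V, RelSeries.head L = primeOfIrreducibleClosed (ι V) := by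
    refine ⟨l.last, ?_⟩
    change OrderDual.ofDual (RelSeries.head l') = _
    simp only [l', RelSeries.head_reverse]
    rfl
  have hker : RingHom.ker (algebraMap (MvPolynomial (Fin n) ℂ) (MvPolynomial (Fin m) ℂ)) ≤
      (RelSeries.head L).asIdeal := by
    rw [hV]
    intro p hp a ha
    obtain ⟨x, rfl⟩ := closure_minimal (Subtype.coe_image_subset _ _) hcl ha
    refine (eval_polynomialMap F x p).trans ?_
    rw [show MvPolynomial.aeval F p = 0 from hp, map_zero]
  obtain ⟨Q, -, hQ, hQL⟩ := Ideal.exists_ideal_over_prime_of_isIntegral (RelSeries.head L).asIdeal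
    (⊥ : Ideal (MvPolynomial (Fin m) ℂ)) hker
  have : Q.LiesOver (RelSeries.head L).asIdeal := ⟨hQL.symm⟩
  obtain ⟨L', hL', -⟩ := Ideal.exists_ltSeries_of_hasGoingUp L Q
  have h := Order.LTSeries.length_le_krullDim L'
  rw [hL'] at h
  refine h.trans ?_
  have := MvPolynomial.ringKrullDim_of_isNoetherianRing (R := ℂ) (ι := Fin m)
  rw [ringKrullDim] at this
  simp [this]

/-- Closures of images of strictly nested irreducible closed sets stay strictly nested, because in
an integral extension strictly nested primes have strictly nested contractions. -/
theorem le_topologicalKrullDim_range_polynomialMap :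
    (m : WithBot ℕ∞) ≤ topologicalKrullDim (Set.range (polynomialMap F)) := by
  let _ := (MvPolynomial.aeval (R := ℂ) F).toRingHom.toAlgebra
  have : Algebra.IsIntegral (MvPolynomial (Fin n) ℂ) (MvPolynomial (Fin m) ℂ) := ⟨hF⟩
  have halg (p : MvPolynomial (Fin n) ℂ) :
      algebraMap _ (MvPolynomial (Fin m) ℂ) p = MvPolynomial.aeval F p := rfl
  have hdim := MvPolynomial.ringKrullDim_of_isNoetherianRing (R := ℂ) (ι := Fin m)
  rw [ringKrullDim, ← Order.krullDim_orderDual] at hdim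
  have hcont : Continuous (Set.rangeFactorization (polynomialMap F)) :=
    (continuous_polynomialMap F).subtype_mk _
  let g : (PrimeSpectrum (MvPolynomial (Fin m) ℂ))ᵒᵈ →
      TopologicalSpace.IrreducibleCloseds (Set.range (polynomialMap F)) := fun P =>
    TopologicalSpace.IrreducibleCloseds.map _ hcont
      ⟨algebraicSet (OrderDual.ofDual P).asIdeal,
        isIrreducible_algebraicSet _, isClosed_algebraicSet _⟩
  have hg : StrictMono g := by
    intro Q P h
    refine lt_of_le_not_ge (TopologicalSpace.IrreducibleCloseds.map_mono hcont
      (algebraicSet_anti h.le)) fun h' => ?_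
    have hlt : Ideal.comap _ _ < Ideal.comap _ _ := Ideal.IsIntegral.comap_lt_comap
      (R := MvPolynomial (Fin n) ℂ)
      (show (OrderDual.ofDual P).asIdeal < (OrderDual.ofDual Q).asIdeal from h)
    have hclosure : closure (Set.rangeFactorization (polynomialMap F) ''
          algebraicSet ((OrderDual.ofDual P).asIdeal : Set (MvPolynomial (Fin m) ℂ))) ⊆
        closure (Set.rangeFactorization (polynomialMap F) ''
          algebraicSet ((OrderDual.ofDual Q).asIdeal : Set (MvPolynomial (Fin m) ℂ))) := h'
    -- A polynomial in the contraction of `Q` vanishes on the image of the zero set of `Q`, hence on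
    -- its closure, hence on the image of the zero set of `P`.
    refine hlt.not_ge fun p hp => ?_
    rw [Ideal.mem_comap, halg] at hp ⊢
    rw [← idealOfSet_algebraicSet (OrderDual.ofDual P).asIdeal, mem_idealOfSet]
    intro x hx
    have hcl : IsClosed {y : Set.range (polynomialMap F) | MvPolynomial.eval y.1 p = 0} :=
      (isClosed_setOf_eval_eq_zero p).preimage continuous_subtype_val
    have hsub : Set.rangeFactorization (polynomialMap F) ''
        algebraicSet (OrderDual.ofDual Q).asIdeal ⊆
        {y : Set.range (polynomialMap F) | MvPolynomial.eval y.1 p = 0} := by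
      rintro _ ⟨y, hy, rfl⟩
      have hy' : MvPolynomial.eval y (MvPolynomial.aeval F p) = 0 := mem_algebraicSet.1 hy _ hp
      rw [← eval_polynomialMap] at hy'
      exact hy'
    have hxp : Set.rangeFactorization (polynomialMap F) x ∈
        {y : Set.range (polynomialMap F) | MvPolynomial.eval y.1 p = 0} :=
      closure_minimal hsub hcl (hclosure (subset_closure (Set.mem_image_of_mem _ hx)))
    have hp0 : MvPolynomial.eval (polynomialMap F x) p = 0 := hxp
    rwa [eval_polynomialMap] at hp0
  refine le_trans ?_ (Order.krullDim_le_of_strictMono g hg)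
  simp [hdim]

end polynomialMap

/-! ### Finite unions of irreducible closed sets. -/

theorem Topology.IsInducing.isIrreducible_preimage {X Y : Type*} [TopologicalSpace X]
    [TopologicalSpace Y] {f : Y → X} (hf : IsInducing f) {A : Set X} (hA : IsIrreducible A)
    (hAf : A ⊆ Set.range f) : IsIrreducible (f ⁻¹' A) := by
  refine ⟨?_, fun U V hU hV => ?_⟩
  · obtain ⟨a, ha⟩ := hA.1
    obtain ⟨y, rfl⟩ := hAf ha
    exact ⟨y, ha⟩
  · obtain ⟨U, hU', rfl⟩ := hf.isOpen_iff.1 hU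
    obtain ⟨V, hV', rfl⟩ := hf.isOpen_iff.1 hV
    rintro ⟨y, hy, hyU⟩ ⟨z, hz, hzV⟩
    obtain ⟨a, ha, haUV⟩ := hA.2 U V hU' hV' ⟨f y, hy, hyU⟩ ⟨f z, hz, hzV⟩
    obtain ⟨w, rfl⟩ := hAf ha
    exact ⟨w, ha, haUV⟩

/-- If a subspace `Z` is a finite union of an antichain of irreducible closed sets, these are its
irreducible components. -/
theorem image_val_irreducibleComponents {X : Type*} [TopologicalSpace X] {Z : Set X}
    {𝒞 : Set (Set X)} (hfin : 𝒞.Finite) (hirr : ∀ C ∈ 𝒞, IsIrreducible C)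
    (hcl : ∀ C ∈ 𝒞, IsClosed C) (hZ : Z = ⋃₀ 𝒞)
    (hanti : ∀ C ∈ 𝒞, ∀ D ∈ 𝒞, C ⊆ D → C = D) :
    (fun T : Set Z => (Subtype.val '' T : Set X)) '' irreducibleComponents Z = 𝒞 := by
  have hval (C) (hC : C ∈ 𝒞) : Subtype.val '' (Subtype.val ⁻¹' C : Set Z) = C := by
    rw [Subtype.image_preimage_coe, Set.inter_eq_right, hZ]
    exact Set.subset_sUnion_of_mem hC
  have hirr' (C) (hC : C ∈ 𝒞) : IsIrreducible (Subtype.val ⁻¹' C : Set Z) := by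
    refine Topology.IsInducing.subtypeVal.isIrreducible_preimage (hirr C hC) ?_
    rw [Subtype.range_coe, hZ]
    exact Set.subset_sUnion_of_mem hC
  have hsub (S : Set Z) (hS : IsIrreducible S) : ∃ C ∈ 𝒞, S ⊆ Subtype.val ⁻¹' C := by
    have := isIrreducible_iff_sUnion_isClosed.1
      (hS.image Subtype.val continuous_subtype_val.continuousOn) hfin.toFinset
      (by simpa using hcl) (by
        rw [hfin.coe_toFinset, ← hZ]
        exact Subtype.coe_image_subset _ _)
    simpa using this
  ext C
  constructor
  · rintro ⟨T, hT, rfl⟩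
    obtain ⟨C, hC, hTC⟩ := hsub T hT.1
    obtain rfl : T = Subtype.val ⁻¹' C := hTC.antisymm (hT.2 (hirr' C hC) hTC)
    simpa only [hval C hC] using hC
  · intro hC
    refine ⟨Subtype.val ⁻¹' C, ⟨hirr' C hC, fun S hS hCS => ?_⟩, hval C hC⟩
    obtain ⟨D, hD, hSD⟩ := hsub S hS
    have : C ⊆ D := by
      rw [← hval C hC, Set.image_subset_iff]
      exact hCS.trans hSD
    rwa [hanti C hC D hD this]

/-- The largest set of a chain is irreducible, so it lies in one member of the union, and the whole
chain with it. -/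
theorem topologicalKrullDim_le_of_eq_sUnion {X : Type*} [TopologicalSpace X] {Z : Set X}
    {𝒞 : Set (Set X)} (hfin : 𝒞.Finite) (hcl : ∀ C ∈ 𝒞, IsClosed C) (hZ : Z = ⋃₀ 𝒞)
    {d : WithBot ℕ∞} (hd : ∀ C ∈ 𝒞, topologicalKrullDim C ≤ d) : topologicalKrullDim Z ≤ d := by
  refine iSup_le fun l => ?_
  obtain ⟨C, hC, hlC⟩ := isIrreducible_iff_sUnion_isClosed.1
      (l.last.isIrreducible.image Subtype.val continuous_subtype_val.continuousOn) hfin.toFinset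
      (by simpa using hcl) (by
        rw [hfin.coe_toFinset, ← hZ]
        exact Subtype.coe_image_subset _ _)
  have hZcl : IsClosed Z := by
    rw [hZ, Set.sUnion_eq_biUnion]
    exact hfin.isClosed_biUnion hcl
  have hiC (i) : Subtype.val '' (l i : Set Z) ⊆ C :=
    (Set.image_mono (l.monotone (Fin.le_last i))).trans hlC
  let g (i) : TopologicalSpace.IrreducibleCloseds C :=
    ⟨Subtype.val ⁻¹' (Subtype.val '' (l i : Set Z)),
      Topology.IsInducing.subtypeVal.isIrreducible_preimage
        ((l i).isIrreducible.image _ continuous_subtype_val.continuousOn)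
        (by rw [Subtype.range_coe]; exact hiC i),
      ((hZcl.isClosedMap_subtype_val _ (l i).isClosed).preimage continuous_subtype_val)⟩
  have hg : StrictMono g := by
    intro i j hij
    refine lt_of_le_not_ge (show (g i).carrier ⊆ (g j).carrier from
      Set.preimage_mono (Set.image_mono (l.monotone hij.le))) fun h => ?_
    refine (l.strictMono hij).not_ge fun z hz => ?_
    obtain ⟨w, hw, hwz⟩ := h (show (⟨z.1, hiC j ⟨z, hz, rfl⟩⟩ : C) ∈ g j from ⟨z, hz, rfl⟩)
    rwa [← Subtype.ext hwz]
  exact (Order.LTSeries.length_le_krullDim (LTSeries.mk l.length g hg)).trans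
    (hd C (by simpa using hC))

/-! ### Monic polynomials and their coefficient vectors. -/

theorem monicPolynomial_coeff {n : ℕ} {p : Polynomial ℂ} (hp : p.Monic) (hn : p.natDegree = n) :
    monicPolynomial (fun j : Fin n => p.coeff j) = p := by
  conv_rhs => rw [hp.as_sum, hn]
  unfold monicPolynomial
  rw [Fin.sum_univ_eq_sum_range (fun i => Polynomial.C (p.coeff i) * .X ^ i) n]

theorem degree_sum_C_mul_X_pow_lt {R : Type*} [Semiring R] {n : ℕ} (b : Fin n → R) :
    (∑ i : Fin n, Polynomial.C (b i) * Polynomial.X ^ (i : ℕ)).degree < (n : WithBot ℕ) := by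
  refine (Polynomial.degree_sum_le _ _).trans_lt ((Finset.sup_lt_iff (WithBot.bot_lt_coe n)).2 ?_)
  exact fun i _ => (Polynomial.degree_C_mul_X_pow_le _ _).trans_lt (WithBot.coe_lt_coe.2 i.2)

theorem monic_monicPolynomial {n : ℕ} (a : ComplexAffineSpace n) : (monicPolynomial a).Monic :=
  Polynomial.monic_X_pow_add (degree_sum_C_mul_X_pow_lt _)

theorem natDegree_monicPolynomial {n : ℕ} (a : ComplexAffineSpace n) :
    (monicPolynomial a).natDegree = n := by
  rw [monicPolynomial, Polynomial.natDegree_add_eq_left_of_degree_lt, Polynomial.natDegree_X_pow]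
  rw [Polynomial.degree_X_pow]
  exact degree_sum_C_mul_X_pow_lt _

theorem coeff_monicPolynomial {n : ℕ} (a : ComplexAffineSpace n) (j : Fin n) :
    (monicPolynomial a).coeff j = a j := by
  rw [monicPolynomial, Polynomial.coeff_add, Polynomial.coeff_X_pow, if_neg j.2.ne, zero_add,
    Polynomial.finsetSum_coeff, Finset.sum_eq_single j]
  · rw [Polynomial.coeff_C_mul, Polynomial.coeff_X_pow_self, mul_one]
  · intro i _ hij
    rw [Polynomial.coeff_C_mul, Polynomial.coeff_X_pow, if_neg (Fin.val_ne_of_ne hij.symm), mul_zero]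
  · simp

theorem monicPolynomial_injective {n : ℕ} : Function.Injective (monicPolynomial (n := n)) := by
  intro a b h
  funext j
  rw [← coeff_monicPolynomial a, h, coeff_monicPolynomial]

theorem card_roots_monicPolynomial {n : ℕ} (a : ComplexAffineSpace n) :
    (monicPolynomial a).roots.card = n := by
  rw [← (IsAlgClosed.splits (monicPolynomial a)).natDegree_eq_card_roots,
    natDegree_monicPolynomial]

/-! ### Products with prescribed root weights. -/

section weights

variable {m n : ℕ} (w : Fin m → ℕ)

/-- The polynomial `∏ (x - Xᵢ)^{wᵢ}` with indeterminate roots. -/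
noncomputable def genericProduct : Polynomial (MvPolynomial (Fin m) ℂ) :=
  ∏ i, (Polynomial.X - Polynomial.C (MvPolynomial.X i)) ^ w i

theorem monic_prod_X_sub_C_pow {R : Type*} [CommRing R] (x : Fin m → R) :
    (∏ i, (Polynomial.X - Polynomial.C (x i)) ^ w i).Monic :=
  Polynomial.monic_prod_of_monic _ _ fun _ _ => (Polynomial.monic_X_sub_C _).pow _

theorem natDegree_prod_X_sub_C_pow {R : Type*} [CommRing R] [Nontrivial R] (x : Fin m → R) :
    (∏ i, (Polynomial.X - Polynomial.C (x i)) ^ w i).natDegree = ∑ i, w i := by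
  rw [Polynomial.natDegree_prod_of_monic _ _ fun _ _ => (Polynomial.monic_X_sub_C _).pow _]
  exact Finset.sum_congr rfl fun i _ => by
    rw [(Polynomial.monic_X_sub_C _).natDegree_pow, Polynomial.natDegree_X_sub_C, mul_one]

theorem roots_prod_X_sub_C_pow {R : Type*} [CommRing R] [IsDomain R] (x : Fin m → R) :
    (∏ i, (Polynomial.X - Polynomial.C (x i)) ^ w i).roots =
      ∑ i, w i • ({x i} : Multiset R) := by
  rw [Polynomial.roots_prod _ _ (monic_prod_X_sub_C_pow _ x).ne_zero]
  simp [Multiset.bind, Multiset.join, Finset.sum]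

/-- The coefficients of `∏ (x - Xᵢ)^{wᵢ}` below degree `n`. -/
noncomputable def genericCoeff (n : ℕ) (j : Fin n) : MvPolynomial (Fin m) ℂ :=
  (genericProduct w).coeff j

variable {w} (hw : ∑ i, w i = n)

include hw in
theorem monicPolynomial_polynomialMap_genericCoeff (x : ComplexAffineSpace m) :
    monicPolynomial (polynomialMap (genericCoeff w n) x) =
      ∏ i, (Polynomial.X - Polynomial.C (x i)) ^ w i := by
  rw [← monicPolynomial_coeff (monic_prod_X_sub_C_pow w x)
    ((natDegree_prod_X_sub_C_pow w x).trans hw)]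
  congr 1
  funext j
  rw [polynomialMap, genericCoeff, ← Polynomial.coeff_map, genericProduct, Polynomial.map_prod]
  simp only [Polynomial.map_pow, Polynomial.map_sub, Polynomial.map_X, Polynomial.map_C]
  congr 1
  exact Finset.prod_congr rfl fun i _ => by
    rw [show MvPolynomial.eval x (MvPolynomial.X i) = x i from MvPolynomial.eval_X i]

include hw in
theorem isIntegral_aeval_genericCoeff (hpos : ∀ i, 0 < w i) :
    (MvPolynomial.aeval (R := ℂ) (genericCoeff w n)).toRingHom.IsIntegral := by
  intro q
  induction q using MvPolynomial.induction_on with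
  | C c =>
    rw [← show (MvPolynomial.aeval (R := ℂ) (genericCoeff w n)).toRingHom (MvPolynomial.C c) =
      MvPolynomial.C c from MvPolynomial.aeval_C _ _]
    exact RingHom.isIntegralElem_map _
  | add p q hp hq => exact hp.add _ hq
  | mul_X p i hp =>
    refine hp.mul _ ?_
    refine ⟨Polynomial.X ^ n + ∑ j : Fin n, Polynomial.C (MvPolynomial.X j) * Polynomial.X ^ (j : ℕ),
      Polynomial.monic_X_pow_add (degree_sum_C_mul_X_pow_lt _), ?_⟩
    have hgen : (Polynomial.X ^ n + ∑ j : Fin n,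
        Polynomial.C (MvPolynomial.X j) * Polynomial.X ^ (j : ℕ)).map
          (MvPolynomial.aeval (R := ℂ) (genericCoeff w n)).toRingHom = genericProduct w := by
      have hmonic := monic_prod_X_sub_C_pow w (MvPolynomial.X (R := ℂ))
      have hdeg := natDegree_prod_X_sub_C_pow w (MvPolynomial.X (R := ℂ))
      rw [← genericProduct] at hmonic hdeg
      rw [hmonic.as_sum, hdeg, hw, Polynomial.map_add, Polynomial.map_pow, Polynomial.map_X,
        Polynomial.map_sum, ← Fin.sum_univ_eq_sum_range
          (fun j => Polynomial.C ((genericProduct w).coeff j) * Polynomial.X ^ j) n]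
      congr 1
      refine Finset.sum_congr rfl fun j _ => ?_
      rw [Polynomial.map_mul, Polynomial.map_C, Polynomial.map_pow, Polynomial.map_X]
      congr 2
      exact MvPolynomial.aeval_X _ _
    rw [← Polynomial.eval_map, hgen, genericProduct, Polynomial.eval_prod]
    -- Positivity of `w i` is essential: a zero exponent would turn the vanishing factor into 1.
    exact Finset.prod_eq_zero (Finset.mem_univ i) (by simp [(hpos i).ne'])

end weights

/-! ### Coincident root loci and partitions. -/

section partitions

theorem coe_partList {n : ℕ} (μ : n.Partition) : (partList μ : Multiset ℕ) = μ.parts :=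
  Multiset.sort_eq _ _

theorem length_partList {n : ℕ} (μ : n.Partition) : (partList μ).length = μ.parts.card :=
  Multiset.length_sort ..

theorem map_get_partList {n : ℕ} (μ : n.Partition) :
    Finset.univ.val.map (partList μ).get = μ.parts := by
  rw [Fin.univ_val_map, List.ofFn_get, coe_partList]

theorem sum_get_partList {n : ℕ} (μ : n.Partition) : ∑ i, (partList μ).get i = n := by
  rw [Finset.sum, map_get_partList, μ.parts_sum]

theorem get_partList_pos {n : ℕ} (μ : n.Partition) (i) : 0 < (partList μ).get i := by
  refine μ.parts_pos ?_
  rw [← map_get_partList]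
  exact Multiset.mem_map_of_mem _ (Finset.mem_univ i)

theorem coincidentRootLocus_eq_range {n : ℕ} (μ : n.Partition) :
    coincidentRootLocus μ = Set.range (polynomialMap (genericCoeff (partList μ).get n)) := by
  ext a
  refine exists_congr fun x => ?_
  rw [← monicPolynomial_polynomialMap_genericCoeff (sum_get_partList μ) x,
    monicPolynomial_injective.eq_iff, eq_comm]

theorem isIrreducible_coincidentRootLocus {n : ℕ} (μ : n.Partition) :
    IsIrreducible (coincidentRootLocus μ) := by
  rw [coincidentRootLocus_eq_range]
  exact isIrreducible_range_polynomialMap _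

theorem isClosed_coincidentRootLocus {n : ℕ} (μ : n.Partition) :
    IsClosed (coincidentRootLocus μ) := by
  rw [coincidentRootLocus_eq_range]
  exact isClosed_range_polynomialMap (isIntegral_aeval_genericCoeff (sum_get_partList μ) (get_partList_pos μ))

theorem topologicalKrullDim_coincidentRootLocus {n : ℕ} (μ : n.Partition) :
    topologicalKrullDim (coincidentRootLocus μ) = (μ.parts.card : WithBot ℕ∞) := by
  have h := isIntegral_aeval_genericCoeff (sum_get_partList μ) (get_partList_pos μ)
  rw [coincidentRootLocus_eq_range, ← length_partList]
  exact le_antisymm (topologicalKrullDim_range_polynomialMap_le h)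
    (le_topologicalKrullDim_range_polynomialMap h)

theorem mem_coincidentRootLocus_iff {n : ℕ} {μ : n.Partition} {a : ComplexAffineSpace n} :
    a ∈ coincidentRootLocus μ ↔ ∃ x : Fin (partList μ).length → ℂ,
      (monicPolynomial a).roots = ∑ i, (partList μ).get i • ({x i} : Multiset ℂ) := by
  refine exists_congr fun x => ?_
  rw [← roots_prod_X_sub_C_pow]
  refine ⟨fun h => by rw [h], fun h => ?_⟩
  rw [(IsAlgClosed.splits (monicPolynomial a)).eq_prod_roots_of_monic (monic_monicPolynomial a), h]
  exact ((IsAlgClosed.splits _).eq_prod_roots_of_monic (monic_prod_X_sub_C_pow _ x)).symm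

/-- A multiset with at most `k` distinct elements and at least `k` elements is a sum of exactly `k`
constant nonempty multisets. -/
theorem exists_multiset_sum_nsmul_singleton {α : Type*} [DecidableEq α] (s : Multiset α) :
    ∀ k : ℕ, s.toFinset.card ≤ k → k ≤ s.card → ∃ P : Multiset (ℕ × α), P.card = k ∧
      (∀ q ∈ P, 0 < q.1) ∧ s = (P.map fun q => q.1 • ({q.2} : Multiset α)).sum := by
  induction s using Multiset.induction_on with
  | empty => exact fun k _ hk => ⟨0, by simpa using hk.antisymm' (Nat.zero_le _), by simp, by simp⟩
  | cons x s ih =>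
    intro k h1 h2
    rw [Multiset.card_cons] at h2
    rw [Multiset.toFinset_cons] at h1
    -- First option: `x` forms a new block of size 1.
    have hnew (h : s.toFinset.card ≤ k - 1) (hk : 1 ≤ k) : ∃ P : Multiset (ℕ × α), P.card = k ∧
        (∀ q ∈ P, 0 < q.1) ∧ x ::ₘ s = (P.map fun q => q.1 • ({q.2} : Multiset α)).sum := by
      obtain ⟨P, hP, hpos, hs⟩ := ih (k - 1) h (by omega)
      refine ⟨(1, x) ::ₘ P, by rw [Multiset.card_cons, hP]; omega, ?_, ?_⟩
      · simpa using hpos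
      · rw [Multiset.map_cons, Multiset.sum_cons, ← hs, one_nsmul, Multiset.singleton_add]
    have hk : 1 ≤ k := (Finset.card_pos.2 ⟨x, Finset.mem_insert_self _ _⟩).trans_le h1
    by_cases hx : x ∈ s
    · rw [Finset.insert_eq_of_mem (Multiset.mem_toFinset.2 hx)] at h1
      rcases h2.lt_or_eq with h2 | h2
      -- Second option: `s` already fills `k` blocks, and one with value `x` is enlarged.
      · obtain ⟨P, hP, hpos, hs⟩ := ih k h1 (by omega)
        obtain ⟨q, hq, hxq⟩ : ∃ q ∈ P, x = q.2 := by
          rw [hs] at hx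
          obtain ⟨t, ht, hxt⟩ := Multiset.mem_join.1 hx
          obtain ⟨q, hq, rfl⟩ := Multiset.mem_map.1 ht
          exact ⟨q, hq, Multiset.mem_singleton.1 (Multiset.mem_of_mem_nsmul hxt)⟩
        obtain ⟨P, rfl⟩ := Multiset.exists_cons_of_mem hq
        refine ⟨(q.1 + 1, q.2) ::ₘ P, by simpa using hP, fun r hr => ?_, ?_⟩
        · rcases Multiset.mem_cons.1 hr with rfl | hr
          · exact Nat.succ_pos _
          · exact hpos r (Multiset.mem_cons_of_mem hr)
        · rw [hs, Multiset.map_cons, Multiset.map_cons, Multiset.sum_cons, Multiset.sum_cons, hxq,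
            succ_nsmul', add_assoc, Multiset.singleton_add]
      -- Here `k = s.card + 1`, so every element needs its own block.
      · exact hnew (s.toFinset_card_le.trans (by omega)) hk
    · rw [Finset.card_insert_of_notMem (by simpa using hx)] at h1
      exact hnew (by omega) hk

/-- Used to order an unordered family of blocks so that its sizes match the sorted list `partList`.
-/
theorem Multiset.exists_coe_eq_map_eq {α β : Type*} (f : α → β) (L : List β) :
    ∀ P : Multiset α, P.map f = L → ∃ l : List α, (l : Multiset α) = P ∧ l.map f = L := by
  classical
  induction L with
  | nil => exact fun P hP => ⟨[], by simpa using (Multiset.map_eq_zero.1 hP).symm, rfl⟩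
  | cons b L ih =>
    intro P hP
    obtain ⟨a, ha, rfl⟩ := Multiset.mem_map.1
      (show b ∈ P.map f by rw [hP]; exact Multiset.mem_coe.2 List.mem_cons_self)
    obtain ⟨P, rfl⟩ := Multiset.exists_cons_of_mem ha
    rw [Multiset.map_cons, ← Multiset.cons_coe, Multiset.cons_inj_right] at hP
    obtain ⟨l, rfl, rfl⟩ := ih P hP
    exact ⟨a :: l, rfl, rfl⟩

theorem count_sum_nsmul_singleton {α : Type*} [DecidableEq α] {m : ℕ} (w : Fin m → ℕ)
    {x : Fin m → α} (hx : Function.Injective x) (i : Fin m) :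
    (∑ j, w j • ({x j} : Multiset α)).count (x i) = w i := by
  simp [Multiset.count_sum', Multiset.count_singleton, hx.eq_iff]

theorem toFinset_sum_nsmul_singleton {α : Type*} [DecidableEq α] {m : ℕ} {w : Fin m → ℕ}
    (hw : ∀ i, 0 < w i) (x : Fin m → α) :
    (∑ j, w j • ({x j} : Multiset α)).toFinset = Finset.univ.image x := by
  ext z
  rw [Multiset.mem_toFinset, Multiset.mem_sum]
  simp [Multiset.mem_nsmul, (hw _).ne', eq_comm]

/-- The multiplicities of a multiset written with distinct elements are its weights. -/
theorem map_count_sum_nsmul_singleton {α : Type*} [DecidableEq α] {m : ℕ} {w : Fin m → ℕ}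
    (hw : ∀ i, 0 < w i) {x : Fin m → α} (hx : Function.Injective x) {s : Multiset α}
    (hs : s = ∑ j, w j • ({x j} : Multiset α)) :
    s.toFinset.val.map s.count = Finset.univ.val.map w := by
  rw [hs, toFinset_sum_nsmul_singleton hw, Finset.image_val_of_injOn hx.injOn, Multiset.map_map]
  exact Multiset.map_congr rfl fun i _ => count_sum_nsmul_singleton w hx i

theorem eq_of_coincidentRootLocus_subset {n : ℕ} {μ ν : n.Partition}
    (hcard : μ.parts.card = ν.parts.card)
    (h : coincidentRootLocus μ ⊆ coincidentRootLocus ν) : μ = ν := by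
  -- The roots 0, 1, 2, … serve as a convenient choice of distinct values.
  let x : Fin (partList μ).length → ℂ := fun i => (i : ℕ)
  have hx : Function.Injective x := fun i j hij => Fin.ext (Nat.cast_injective (R := ℂ) hij)
  obtain ⟨a, ha⟩ : ∃ a, monicPolynomial a =
      ∏ i, (Polynomial.X - Polynomial.C (x i)) ^ (partList μ).get i :=
    ⟨_, monicPolynomial_polynomialMap_genericCoeff (sum_get_partList μ) x⟩
  have hroots : (monicPolynomial a).roots = ∑ i, (partList μ).get i • ({x i} : Multiset ℂ) := by
    rw [ha, roots_prod_X_sub_C_pow]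
  obtain ⟨y, hy⟩ := mem_coincidentRootLocus_iff.1 (h ⟨x, ha⟩)
  -- The values of `y` are the same roots, as many as `μ` has parts; as `ν` has equally many, none
  -- can coincide.
  have hyinj : Function.Injective y := by
    have h1 := congrArg (fun s => s.toFinset.card) (hroots.symm.trans hy)
    simp only [toFinset_sum_nsmul_singleton (get_partList_pos _),
      Finset.card_image_of_injective _ hx] at h1
    rw [← Set.injOn_univ, ← Finset.coe_univ]
    refine Finset.card_image_iff.1 (h1.symm.trans ?_)
    simp [length_partList, hcard]
  ext1
  rw [← map_get_partList μ, ← map_get_partList ν,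
    ← map_count_sum_nsmul_singleton (get_partList_pos μ) hx hroots,
    map_count_sum_nsmul_singleton (get_partList_pos ν) hyinj hy]

theorem distinctRootLocus_eq_iUnion {n k : ℕ} (hk : k ≤ n) :
    distinctRootLocus n k =
      ⋃ μ ∈ {μ : n.Partition | μ.parts.card = k}, coincidentRootLocus μ := by
  ext a
  simp only [Set.mem_iUnion, Set.mem_ofPred_eq, exists_prop]
  constructor
  · intro ha
    obtain ⟨P, hP, hpos, hs⟩ := exists_multiset_sum_nsmul_singleton (monicPolynomial a).roots k ha
      (hk.trans_eq (card_roots_monicPolynomial a).symm)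
    let μ : n.Partition := ⟨P.map Prod.fst, fun {i} hi => by
        obtain ⟨q, hq, rfl⟩ := Multiset.mem_map.1 hi
        exact hpos q hq, by
        rw [← card_roots_monicPolynomial a, hs]
        refine Eq.trans ?_ (Multiset.card_join _).symm
        simp⟩
    refine ⟨μ, by simp [μ, hP], mem_coincidentRootLocus_iff.2 ?_⟩
    obtain ⟨l, rfl, hl⟩ := Multiset.exists_coe_eq_map_eq Prod.fst (partList μ) P
      (coe_partList μ).symm
    rw [← hl]
    refine ⟨fun i => (l.get (i.cast (List.length_map _))).2, ?_⟩
    rw [hs, Multiset.map_coe, Multiset.sum_coe, ← List.sum_ofFn]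
    congr 1
    refine List.ext_get (by simp) fun i _ _ => ?_
    simp
  · rintro ⟨μ, rfl, ha⟩
    obtain ⟨x, hx⟩ := mem_coincidentRootLocus_iff.1 ha
    have hsub : (monicPolynomial a).roots.toFinset ⊆ Finset.univ.image x := by
      intro z hz
      rw [Multiset.mem_toFinset, hx, Multiset.mem_sum] at hz
      obtain ⟨i, -, hi⟩ := hz
      rw [Multiset.mem_singleton.1 (Multiset.mem_of_mem_nsmul hi)]
      exact Finset.mem_image_of_mem _ (Finset.mem_univ _)
    refine (Finset.card_le_card hsub).trans (Finset.card_image_le.trans ?_)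
    simp [length_partList]

end partitions

theorem corollary4p3 (n : ℕ) (hn : 1 ≤ n) :
    (∀ μ : n.Partition,
      IsIrreducible (coincidentRootLocus μ) ∧
      IsClosed (coincidentRootLocus μ) ∧
      topologicalKrullDim (coincidentRootLocus μ) = (μ.parts.card : WithBot ℕ∞)) ∧
    (∀ k : ℕ, 1 ≤ k → k ≤ n →
      -- `Z_k` is the union of the `C_μ` with `#μ = k`
      (distinctRootLocus n k =
        ⋃ μ ∈ {μ : n.Partition | μ.parts.card = k}, coincidentRootLocus μ) ∧
      -- the union is irredundant (so distinct partitions give distinct members)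
      (∀ μ ν : n.Partition, μ.parts.card = k → ν.parts.card = k →
        coincidentRootLocus μ ⊆ coincidentRootLocus ν → μ = ν) ∧
      -- its members are exactly the irreducible components of `Z_k`
      (fun T : Set (distinctRootLocus n k) => (Subtype.val '' T : Set (ComplexAffineSpace n))) ''
          irreducibleComponents (distinctRootLocus n k) =
        coincidentRootLocus '' {μ : n.Partition | μ.parts.card = k} ∧
      -- `Z_k` is equidimensional of dimension `k`
      (∀ T ∈ irreducibleComponents (distinctRootLocus n k),
        topologicalKrullDim T = (k : WithBot ℕ∞)) ∧
      topologicalKrullDim (distinctRootLocus n k) = (k : WithBot ℕ∞)) := by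
  refine ⟨fun μ => ⟨isIrreducible_coincidentRootLocus μ, isClosed_coincidentRootLocus μ,
    topologicalKrullDim_coincidentRootLocus μ⟩, fun k hk hkn => ?_⟩
  have hunion := distinctRootLocus_eq_iUnion hkn
  have hirred (μ ν : n.Partition) (hμ : μ.parts.card = k) (hν : ν.parts.card = k)
      (h : coincidentRootLocus μ ⊆ coincidentRootLocus ν) : μ = ν :=
    eq_of_coincidentRootLocus_subset (hμ.trans hν.symm) h
  have hsUnion : distinctRootLocus n k =
      ⋃₀ (coincidentRootLocus '' {μ : n.Partition | μ.parts.card = k}) := by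
    rw [hunion, Set.sUnion_image]
  have hfin : (coincidentRootLocus '' {μ : n.Partition | μ.parts.card = k}).Finite :=
    (Set.toFinite _).image _
  have hcl : ∀ C ∈ coincidentRootLocus '' {μ : n.Partition | μ.parts.card = k}, IsClosed C := by
    rintro _ ⟨μ, -, rfl⟩
    exact isClosed_coincidentRootLocus μ
  have hcomp := image_val_irreducibleComponents hfin
    (by rintro _ ⟨μ, -, rfl⟩; exact isIrreducible_coincidentRootLocus μ) hcl hsUnion
    (by rintro _ ⟨μ, hμ, rfl⟩ _ ⟨ν, hν, rfl⟩ h; rw [hirred μ ν hμ hν h])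
  have hdim : ∀ T ∈ irreducibleComponents (distinctRootLocus n k),
      topologicalKrullDim T = (k : WithBot ℕ∞) := by
    intro T hT
    obtain ⟨μ, hμ, hμT⟩ := hcomp.subset (Set.mem_image_of_mem _ hT)
    rw [(Topology.IsEmbedding.subtypeVal.homeomorphImage T).isHomeomorph.topologicalKrullDim_eq,
      ← hμT, topologicalKrullDim_coincidentRootLocus, hμ]
  refine ⟨hunion, hirred, hcomp, hdim, le_antisymm ?_ ?_⟩
  · refine topologicalKrullDim_le_of_eq_sUnion hfin hcl hsUnion ?_
    rintro _ ⟨μ, hμ, rfl⟩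
    rw [topologicalKrullDim_coincidentRootLocus, hμ]
  -- The polynomial `Xⁿ` has one distinct root and `k ≥ 1`, so `Z_k` is nonempty; the component
  -- through this point has dimension `k`.
  · let a : ComplexAffineSpace n := fun _ => 0
    have ha : a ∈ distinctRootLocus n k := by
      have : monicPolynomial a = Polynomial.X ^ n := by simp [monicPolynomial, a]
      change (monicPolynomial a).roots.toFinset.card ≤ k
      rw [this, Polynomial.roots_X_pow, Multiset.toFinset_nsmul _ _ (by omega)]
      simpa using hk
    rw [← hdim _ (irreducibleComponent_mem_irreducibleComponents (⟨a, ha⟩ : distinctRootLocus n k))]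
    exact topologicalKrullDim_subspace_le _ _
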